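/- For integers $p \ge 3$ and $n \ge 0$, let $H_p^n$ be the Hanoi graph of the Tower of Hanoi puzzle with $n$ discs $d_1, \dots, d_n$ of increasing size and $p$ pegs: its vertices are the $p^n$ configurations $\tau \colon \{d_1,\dots,d_n\} \to \{1,\dots,p\}$, and two configurations are adjacent if and only if one is obtained from the other by a single legal move, i.e. by moving one disc to a different peg, where no smaller disc lies on its old peg or on its new peg. The treewidth of a finite graph is the smallest width of a tree decomposition of it, the width being one less than the cardinality of a largest bag. Then for every fixed $p \ge 3$, the treewidth of $H_p^n$ is $\Theta((p-2)^n)$ as $n \to \infty$, with constants depending only on $p$. -/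

import Mathlib

open Asymptotics Filter

/-- A configuration of the Tower of Hanoi puzzle with `n` discs and `p` pegs: the peg of each disc.
The disc `i` is larger than the disc `j` when `j < i`. -/
abbrev HanoiConfig (p n : ℕ) : Type := Fin n → Fin p

/-- `τ'` arises from `τ` by one legal move: a single disc `d` changes its peg, where `d` is the
topmost disc of its old peg and every disc on its new peg is larger than `d`. -/
def HanoiMove {p n : ℕ} (τ τ' : HanoiConfig p n) : Prop :=
  ∃ d : Fin n, τ' d ≠ τ d ∧ (∀ e, e ≠ d → τ' e = τ e) ∧
    (∀ e, e < d → τ e ≠ τ d) ∧ (∀ e, e < d → τ e ≠ τ' d)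

theorem HanoiMove.symm {p n : ℕ} {τ τ' : HanoiConfig p n} (h : HanoiMove τ τ') :
    HanoiMove τ' τ := by
  obtain ⟨d, h1, h2, h3, h4⟩ := h
  refine ⟨d, h1.symm, fun e he => (h2 e he).symm, fun e he => ?_, fun e he => ?_⟩
  · rw [h2 e he.ne]; exact h4 e he
  · rw [h2 e he.ne]; exact h3 e he

/-- The Hanoi graph `H_p^n` on the `p ^ n` configurations of `n` discs on `p` pegs; edges join the
configurations that differ by one legal move. -/
def hanoiGraph (p n : ℕ) : SimpleGraph (HanoiConfig p n) where
  Adj := HanoiMove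
  symm := ⟨fun _ _ h => h.symm⟩
  loopless := ⟨fun _ h => by obtain ⟨d, hd, _⟩ := h; exact hd rfl⟩

/-- A tree decomposition of `G` whose tree has the node set `ι`. -/
structure TreeDecomposition {V : Type*} (G : SimpleGraph V) (ι : Type*) where
  /-- the underlying tree -/
  tree : SimpleGraph ι
  isTree : tree.IsTree
  /-- the bag at a node of the tree -/
  bag : ι → Finset V
  /-- every vertex lies in some bag -/
  exists_mem_bag : ∀ v : V, ∃ i, v ∈ bag i
  /-- both ends of every edge lie in a common bag -/
  exists_edge_bag : ∀ u v : V, G.Adj u v → ∃ i, u ∈ bag i ∧ v ∈ bag i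
  /-- the nodes whose bags contain a given vertex induce a nonempty connected subtree -/
  connected_bags : ∀ v : V, (tree.induce {i | v ∈ bag i}).Connected

/-- The width: the cardinality of the largest bag, minus one.
(If `V` is nonempty then some bag is nonempty and the subtraction does not truncate.) -/
def TreeDecomposition.width {V : Type*} {G : SimpleGraph V} {ι : Type*} [Fintype ι]
    (D : TreeDecomposition G ι) : ℕ :=
  (Finset.univ.sup fun i => (D.bag i).card) - 1

/-- The treewidth of a graph on a finite nonempty vertex set: the smallest width of a
tree decomposition with a finite tree. -/
noncomputable def treewidth {V : Type*} [Finite V] [Nonempty V] (G : SimpleGraph V) : ℕ :=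
  sInf {w : ℕ | ∃ (ι : Type) (_ : Fintype ι) (D : TreeDecomposition G ι), D.width = w}

/-! Upper bound: the bags follow the tree of positions of the largest discs. At level `k` the discs
`≥ k` are fixed, disc `k - 1` is free and the smaller ones avoid two pegs, which is what a move of
disc `k - 1` requires. This gives at most `p ^ 2 * p * (p - 2) ^ n` configurations per bag.

Lower bound: if removing any `k` vertices leaves a component with more than half of the vertices,
the width is at least `k` (`le_width_of_forall_reachableAvoiding`). Such a component is found by
counting pairs `(z, y)` separated by `X`, where `z` avoids two given pegs: there are at most `|X| *
p ^ (n + 1)` (`card_separatedPairs_le`). Without a large component, each of the `(p - 2) ^ n`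
choices of `z` would be separated from at least half of all `y`, forcing `(p - 2) ^ n ≤ 2 * p *
|X|`.

The count is by induction on the discs. To bring the largest disc from `i` to `j`, the smaller ones
clear these pegs by two swaps of an empty peg with another one. Different `z` perform a swap inside
disjoint sets of configurations, so each vertex of `X` blocks at most one `z`. -/

/-! ### Walks avoiding a set, and trees -/

namespace SimpleGraph

variable {V ι : Type*} {G : SimpleGraph V} {X : Finset V} {u v w : V}

/-- `u` and `v` lie outside `X` and are joined by a walk of `G` that does not meet `X`. -/
def ReachableAvoiding (G : SimpleGraph V) (X : Finset V) (u v : V) : Prop :=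
  -- The first clause rules out the trivial walk at a vertex of `X`.
  u ∉ X ∧ Relation.ReflTransGen (fun a b => G.Adj a b ∧ a ∉ X ∧ b ∉ X) u v

namespace ReachableAvoiding

theorem refl (hu : u ∉ X) : G.ReachableAvoiding X u u := ⟨hu, .refl⟩

theorem left_notMem (h : G.ReachableAvoiding X u v) : u ∉ X := h.1

theorem right_notMem (h : G.ReachableAvoiding X u v) : v ∉ X := by
  obtain ⟨hu, h⟩ := h
  cases h with
  | refl => exact hu
  | tail _ h => exact h.2.2

theorem trans (h : G.ReachableAvoiding X u v) (h' : G.ReachableAvoiding X v w) :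
    G.ReachableAvoiding X u w := ⟨h.1, h.2.trans h'.2⟩

theorem symm (h : G.ReachableAvoiding X u v) : G.ReachableAvoiding X v u := by
  refine ⟨h.right_notMem, ?_⟩
  have : Std.Symm (fun a b => G.Adj a b ∧ a ∉ X ∧ b ∉ X) :=
    ⟨fun _ _ h => ⟨h.1.symm, h.2.2, h.2.1⟩⟩
  exact Relation.ReflTransGen.stdSymm.symm _ _ h.2

theorem of_adj (h : G.Adj u v) (hu : u ∉ X) (hv : v ∉ X) : G.ReachableAvoiding X u v :=
  ⟨hu, .single ⟨h, hu, hv⟩⟩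

theorem map {V' : Type*} {G' : SimpleGraph V'} {X' : Finset V'} (f : V → V')
    (hf : ∀ a b, G.Adj a b → G'.Adj (f a) (f b)) (hX : ∀ a, a ∉ X → f a ∉ X')
    (h : G.ReachableAvoiding X u v) : G'.ReachableAvoiding X' (f u) (f v) :=
  ⟨hX _ h.1, h.2.lift f fun _ _ h => ⟨hf _ _ h.1, hX _ h.2.1, hX _ h.2.2⟩⟩

end ReachableAvoiding

/-- In a finite tree, a map that sends every vertex to a neighbour has a two-cycle. -/
theorem IsTree.exists_apply_apply_eq [Finite ι] {T : SimpleGraph ι} (hT : T.IsTree) (f : ι → ι)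
    (hf : ∀ t, T.Adj t (f t)) : ∃ t, f (f t) = t := by
  classical
  have := Fintype.ofFinite ι
  -- A tree has fewer edges than vertices, so two vertices select the same edge.
  let g : ι → T.edgeSet := fun t => ⟨s(t, f t), hf t⟩
  have hcard := hT.card_edgeFinset
  have hlt : Fintype.card T.edgeSet < Fintype.card ι := by
    rw [← hcard, edgeFinset_card]; omega
  obtain ⟨s, t, hst, h⟩ := Fintype.exists_ne_map_eq_of_card_lt g hlt
  have h' : s(s, f s) = s(t, f t) := congrArg Subtype.val h
  rw [Sym2.eq_iff] at h'
  rcases h' with ⟨h1, _⟩ | ⟨h1, h2⟩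
  · exact absurd h1 hst
  · exact ⟨s, by rw [h2, ← h1]⟩

/-- The neighbour of `t` on the way to another vertex `s` of a connected graph. -/
theorem Connected.exists_adj_reachable_deleteIncidenceSet {T : SimpleGraph ι} (hT : T.Connected)
    {s t : ι} (h : t ≠ s) : ∃ t', T.Adj t t' ∧ (T.deleteIncidenceSet t).Reachable t' s := by
  classical
  obtain ⟨p, hp⟩ := hT.exists_isPath t s
  cases p with
  | nil => exact absurd rfl h
  | @cons _ t' _ hadj p =>
    refine ⟨t', hadj, ?_⟩
    rw [Walk.cons_isPath_iff] at hp
    clear hadj h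
    have ht := hp.2
    clear hp
    induction p with
    | nil => exact .refl _
    | cons h' p ih =>
      rw [Walk.support_cons, List.mem_cons, not_or] at ht
      refine Reachable.trans (Adj.reachable ?_) (ih ht.2)
      rw [deleteIncidenceSet_adj]
      exact ⟨h', Ne.symm ht.1, fun h => ht.2 (h ▸ p.start_mem_support)⟩

end SimpleGraph

/-! ### Width and large components -/

namespace TreeDecomposition

open SimpleGraph

variable {V ι : Type*} {G : SimpleGraph V} (D : TreeDecomposition G ι)

/-- The nodes of a vertex outside the bag at `t` are not separated by `t`. -/
theorem reachable_of_mem_bag {t a b : ι} {v : V} (ht : v ∉ D.bag t) (ha : v ∈ D.bag a)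
    (hb : v ∈ D.bag b) : (D.tree.deleteIncidenceSet t).Reachable a b := by
  let f : D.tree.induce {i | v ∈ D.bag i} →g D.tree.deleteIncidenceSet t :=
    { toFun := Subtype.val
      map_rel' := by
        rintro ⟨x, hx⟩ ⟨y, hy⟩ h
        rw [deleteIncidenceSet_adj]
        refine ⟨h, ?_, ?_⟩
        · rintro rfl; exact ht hx
        · rintro rfl; exact ht hy }
  exact ((D.connected_bags v).preconnected ⟨a, ha⟩ ⟨b, hb⟩).map f

/-- The nodes of a connected set of vertices outside the bag at `t` are not separated by `t`. -/
theorem reachable_of_reachableAvoiding {t a b : ι} {u v : V}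
    (h : G.ReachableAvoiding (D.bag t) u v) (ha : u ∈ D.bag a) (hb : v ∈ D.bag b) :
    (D.tree.deleteIncidenceSet t).Reachable a b := by
  obtain ⟨hu, h⟩ := h
  induction h generalizing b with
  | refl => exact D.reachable_of_mem_bag hu ha hb
  | tail _ h ih =>
    obtain ⟨i, hi, hi'⟩ := D.exists_edge_bag _ _ h.1
    exact (ih hi).trans (D.reachable_of_mem_bag h.2.2 hi' hb)

/-- A graph in which the removal of any `k` vertices leaves more than half of the vertices
connected has no tree decomposition of width less than `k`. -/
theorem le_width_of_forall_reachableAvoiding [Fintype V] [Fintype ι] {k : ℕ}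
    (h : ∀ X : Finset V, X.card ≤ k → ∃ z, ∃ B : Finset V,
      Fintype.card V < 2 * B.card ∧ ∀ y ∈ B, G.ReachableAvoiding X z y) :
    k ≤ D.width := by
  classical
  by_contra! hlt
  have hcard : ∀ t, (D.bag t).card ≤ k := fun t => by
    have := Finset.le_sup (f := fun i => (D.bag i).card) (Finset.mem_univ t)
    simp only [width] at hlt
    omega
  choose z B hB hr using fun t => h (D.bag t) (hcard t)
  have hz : ∀ t, z t ∉ D.bag t := fun t => by
    have : (B t).Nonempty := by
      rw [← Finset.card_pos]; have := hB t; omega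
    obtain ⟨y, hy⟩ := this
    exact (hr t y hy).left_notMem
  choose s hs using fun t => D.exists_mem_bag (z t)
  -- Each node points to its neighbour in the direction of its large component.
  choose f hf hf' using fun t => D.isTree.connected.exists_adj_reachable_deleteIncidenceSet
    (s := s t) (t := t) (by intro h; apply hz t; have := hs t; rwa [← h] at this)
  obtain ⟨t, ht⟩ := D.isTree.exists_apply_apply_eq f hf
  -- Two sets that each contain more than half of the vertices meet. A node of a common vertex is
  -- then reached from `f t` avoiding `t` and from `t` avoiding `f t`, so the edge between them is
  -- not a bridge.
  obtain ⟨y, hy⟩ : (B t ∩ B (f t)).Nonempty := by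
    rw [← Finset.card_pos]
    have h1 := Finset.card_union_add_card_inter (B t) (B (f t))
    have h2 := Finset.card_le_univ (B t ∪ B (f t))
    have h3 := hB t
    have h4 := hB (f t)
    omega
  rw [Finset.mem_inter] at hy
  obtain ⟨b, hb⟩ := D.exists_mem_bag y
  have h1 := (hf' t).trans (D.reachable_of_reachableAvoiding (hr t y hy.1) (hs t) hb)
  have h2 := (hf' (f t)).trans
    (D.reachable_of_reachableAvoiding (hr (f t) y hy.2) (hs (f t)) hb)
  rw [ht] at h2
  have hbridge := isAcyclic_iff_forall_adj_isBridge.1 D.isTree.isAcyclic (hf t)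
  rw [isBridge_iff] at hbridge
  have key : ∀ x, x = t ∨ x = f t →
      D.tree.deleteIncidenceSet x ≤ D.tree.deleteEdges {s(t, f t)} := by
    intro x hx a b hab
    rw [deleteIncidenceSet_adj] at hab
    rw [deleteEdges_adj]
    refine ⟨hab.1, fun h => ?_⟩
    rw [Set.mem_singleton_iff, Sym2.eq_iff] at h
    grind
  exact hbridge ((h2.mono (key _ (.inr rfl))).trans (h1.mono (key _ (.inl rfl))).symm)

theorem card_bag_le_width_add_one [Fintype ι] (t : ι) : (D.bag t).card ≤ D.width + 1 := by
  have := Finset.le_sup (f := fun i => (D.bag i).card) (Finset.mem_univ t)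
  simp only [width]
  omega

theorem one_le_width_of_adj [Fintype ι] {u v : V} (h : G.Adj u v) : 1 ≤ D.width := by
  classical
  obtain ⟨i, hu, hv⟩ := D.exists_edge_bag u v h
  have h1 : ({u, v} : Finset V).card ≤ (D.bag i).card :=
    Finset.card_le_card (by intro x; simp; rintro (rfl | rfl) <;> assumption)
  rw [Finset.card_pair h.ne] at h1
  have := D.card_bag_le_width_add_one i
  omega

theorem treewidth_le [Finite V] [Nonempty V] {ι : Type} [Fintype ι] (D : TreeDecomposition G ι) :
    treewidth G ≤ D.width := Nat.sInf_le ⟨ι, _, D, rfl⟩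

end TreeDecomposition

/-- The treewidth is attained as soon as there is a tree decomposition. -/
theorem exists_width_eq_treewidth {V : Type*} [Finite V] [Nonempty V] {G : SimpleGraph V}
    {ι : Type} [Fintype ι] (D : TreeDecomposition G ι) :
    ∃ (κ : Type) (_ : Fintype κ) (D' : TreeDecomposition G κ), D'.width = treewidth G :=
  Nat.sInf_mem (s := {w | ∃ (κ : Type) (_ : Fintype κ) (D : TreeDecomposition G κ), D.width = w})
    ⟨D.width, ι, ‹_›, D, rfl⟩

/-! ### Upper bound: the canonical tree decomposition -/

/-- The graph of a parent function that increases towards a root is a tree. -/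
theorem SimpleGraph.isTree_fromRel_parent {ι : Type*} [Finite ι] (r : ι) (parent : ι → ι)
    (h : ι → ℕ) (hlt : ∀ t, t ≠ r → h (parent t) < h t) :
    (SimpleGraph.fromRel fun s t => s ≠ r ∧ parent s = t).IsTree := by
  classical
  have := Fintype.ofFinite ι
  set T := SimpleGraph.fromRel fun s t => s ≠ r ∧ parent s = t with hT
  have hreach : ∀ m t, h t = m → T.Reachable t r := by
    intro m
    induction m using Nat.strong_induction_on with
    | _ m ih =>
      intro t ht
      by_cases htr : t = r
      · rw [htr]
      · have h1 := hlt t htr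
        refine Reachable.trans (Adj.reachable ?_) (ih _ (ht ▸ h1) (parent t) rfl)
        rw [hT, fromRel_adj]
        exact ⟨fun he => by rw [← he] at h1; exact lt_irrefl _ h1, .inl ⟨htr, rfl⟩⟩
  have hconn : T.Connected :=
    { preconnected := fun s t => (hreach _ s rfl).trans (hreach _ t rfl).symm
      nonempty := ⟨r⟩ }
  rw [isTree_iff_connected_and_card]
  refine ⟨hconn, le_antisymm ?_ hconn.card_vert_le_card_edgeSet_add_one⟩
  -- Every edge joins a non-root vertex to its parent, so there are fewer edges than vertices.
  have hsub : T.edgeSet ⊆ (fun t => s(t, parent t)) '' {t | t ≠ r} := by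
    intro e
    induction e with
    | _ a b =>
      intro hab
      rw [mem_edgeSet, hT, fromRel_adj] at hab
      rcases hab.2 with ⟨h1, h2⟩ | ⟨h1, h2⟩
      · exact ⟨a, h1, by rw [← h2]⟩
      · exact ⟨b, h1, by rw [← h2]; exact Sym2.eq_swap⟩
  have h1 : Nat.card T.edgeSet ≤ ({t | t ≠ r} : Set ι).ncard :=
    (Set.ncard_le_ncard hsub (Set.toFinite _)).trans (Set.ncard_image_le (Set.toFinite _))
  have h2 : ({t | t ≠ r} : Set ι).ncard + 1 = Nat.card ι := by
    have := Set.ncard_add_ncard_compl ({r} : Set ι)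
    rw [Set.ncard_singleton] at this
    rw [← this, add_comm]; rfl
  omega

/-- The nodes of the canonical tree decomposition of the Hanoi graph: a number `k` and positions of
the discs `≥ k`, extended by zero. -/
abbrev HanoiNode (p n : ℕ) [NeZero p] : Type :=
  {x : Fin (n + 1) × (Fin n → Fin p) // ∀ e : Fin n, (e : ℕ) < (x.1 : ℕ) → x.2 e = 0}

namespace HanoiNode

variable {p n : ℕ} [NeZero p]

/-- The node at level `k` given by the discs `≥ k` of a configuration. -/
def ofConfig (k : ℕ) (hk : k ≤ n) (τ : HanoiConfig p n) : HanoiNode p n :=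
  ⟨(⟨k, Nat.lt_succ_of_le hk⟩, fun e => if (e : ℕ) < k then 0 else τ e), fun e he => by
    simpa using fun h => absurd he (not_lt.2 h)⟩

/-- Forget the smallest remaining disc. -/
def parent (x : HanoiNode p n) : HanoiNode p n :=
  if h : (x.1.1 : ℕ) < n then ofConfig (x.1.1 + 1) h x.1.2 else x

theorem parent_ofConfig {k : ℕ} (hk : k < n) (τ : HanoiConfig p n) :
    parent (ofConfig k hk.le τ) = ofConfig (k + 1) hk τ := by
  have h : ((ofConfig k hk.le τ).1.1 : ℕ) < n := hk
  rw [parent, dif_pos h]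
  apply Subtype.ext
  refine Prod.ext rfl (funext fun e => ?_)
  change (if (e : ℕ) < k + 1 then 0 else if (e : ℕ) < k then 0 else τ e) =
    if (e : ℕ) < k + 1 then 0 else τ e
  split_ifs <;> first | rfl | omega

theorem eq_root {x : HanoiNode p n} (h : ¬ (x.1.1 : ℕ) < n) : x = ofConfig n le_rfl 0 := by
  have hx : (x.1.1 : ℕ) = n := by have := x.1.1.2; omega
  apply Subtype.ext
  refine Prod.ext (Fin.ext hx) (funext fun e => ?_)
  rw [x.2 e (by rw [hx]; exact e.2)]
  simp [ofConfig]

/-- The configurations at a node: those with the given positions of the discs `≥ k` and two pegs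
without discs `< k - 1`. -/
def bag (x : HanoiNode p n) : Finset (HanoiConfig p n) :=
  Finset.univ.filter fun τ => (∀ e : Fin n, (x.1.1 : ℕ) ≤ e → τ e = x.1.2 e) ∧
    ∃ a b, a ≠ b ∧ ∀ e : Fin n, (e : ℕ) + 1 < x.1.1 → τ e ≠ a ∧ τ e ≠ b

/-- A configuration thus lies in at most one bag per level, which makes its nodes a path. -/
theorem eq_ofConfig {x : HanoiNode p n} {τ : HanoiConfig p n} (h : τ ∈ x.bag) :
    x = ofConfig x.1.1 (Nat.le_of_lt_succ x.1.1.2) τ := by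
  rw [bag, Finset.mem_filter] at h
  apply Subtype.ext
  refine Prod.ext rfl (funext fun e => ?_)
  simp only [ofConfig]
  split_ifs with he
  · exact x.2 e he
  · exact (h.2.1 e (not_lt.1 he)).symm

theorem mem_bag_ofConfig {k : ℕ} {hk : k ≤ n} {τ σ : HanoiConfig p n} :
    σ ∈ (ofConfig k hk τ).bag ↔ (∀ e : Fin n, k ≤ e → σ e = τ e) ∧
      ∃ a b, a ≠ b ∧ ∀ e : Fin n, (e : ℕ) + 1 < k → σ e ≠ a ∧ σ e ≠ b := by
  rw [bag, Finset.mem_filter]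
  simp only [ofConfig, Finset.mem_univ, true_and]
  refine and_congr_left fun _ => forall_congr' fun e => imp_congr_right fun he => ?_
  rw [if_neg (not_lt.2 he)]

theorem mem_bag_zero (hp : 3 ≤ p) (τ : HanoiConfig p n) :
    τ ∈ (ofConfig 0 (Nat.zero_le n) τ).bag := by
  rw [mem_bag_ofConfig]
  refine ⟨fun _ _ => rfl, ⟨0, by omega⟩, ⟨1, by omega⟩, by simp, fun e he => ?_⟩
  omega

theorem card_bag_le (hp : 3 ≤ p) (x : HanoiNode p n) : x.bag.card ≤ p ^ 3 * (p - 2) ^ n := by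
  classical
  let S : Fin p × Fin p → Fin n → Finset (Fin p) := fun c e =>
    if (x.1.1 : ℕ) ≤ e then {x.1.2 e}
      else if (e : ℕ) + 1 < x.1.1 then Finset.univ \ {c.1, c.2} else Finset.univ
  have hsub : x.bag ⊆ (Finset.univ.filter fun c : Fin p × Fin p => c.1 ≠ c.2).biUnion
      fun c => Fintype.piFinset (S c) := by
    intro τ hτ
    rw [bag, Finset.mem_filter] at hτ
    obtain ⟨-, h, a, b, hab, h'⟩ := hτ
    rw [Finset.mem_biUnion]
    refine ⟨(a, b), by simpa using hab, ?_⟩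
    rw [Fintype.mem_piFinset]
    intro e
    simp only [S]
    split_ifs with h1 h2
    · simpa using h e h1
    · simpa using h' e h2
    · simp
  have hS : ∀ c ∈ Finset.univ.filter fun c : Fin p × Fin p => c.1 ≠ c.2,
      (Fintype.piFinset (S c)).card ≤ p * (p - 2) ^ n := by
    intro c hc
    rw [Finset.mem_filter] at hc
    rw [Fintype.card_piFinset]
    calc ∏ e, (S c e).card
        -- Fixed discs contribute `1 ≤ p - 2`; only disc `k - 1` can exceed `p - 2`, at the cost of
        -- one factor `p`.
        ≤ ∏ e : Fin n, (if (e : ℕ) + 1 = x.1.1 then p else 1) * (p - 2) := by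
          refine Finset.prod_le_prod' fun e _ => ?_
          simp only [S]
          split_ifs with h1 h2 h3 h4
          · omega
          · simp; omega
          · omega
          · rw [Finset.card_sdiff_of_subset (Finset.subset_univ _), Finset.card_pair hc.2]
            simp
          · rw [Finset.card_univ, Fintype.card_fin]
            exact Nat.le_mul_of_pos_right _ (by omega)
          · omega
      _ = (∏ e : Fin n, if (e : ℕ) + 1 = x.1.1 then p else 1) * (p - 2) ^ n := by
          rw [Finset.prod_mul_distrib]; simp
      _ ≤ p * (p - 2) ^ n := by
          refine Nat.mul_le_mul_right _ ?_
          by_cases he : ∃ e : Fin n, (e : ℕ) + 1 = x.1.1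
          · obtain ⟨e, he⟩ := he
            rw [Finset.prod_eq_single e]
            · rw [if_pos he]
            · intro b _ hb
              rw [if_neg]
              intro h
              exact hb (Fin.ext (by omega))
            · simp
          · push Not at he
            rw [Finset.prod_eq_one fun e _ => if_neg (he e)]
            omega
  calc x.bag.card ≤ _ := Finset.card_le_card hsub
    _ ≤ _ := Finset.card_biUnion_le_card_mul _ _ _ hS
    _ ≤ (p * p) * (p * (p - 2) ^ n) := by
        refine Nat.mul_le_mul_right _ ((Finset.card_le_univ _).trans ?_)
        simp
    _ = _ := by ring

end HanoiNode

/-- The tree decomposition of the Hanoi graph along the tree of positions of the largest discs. -/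
def hanoiTreeDecomposition (p n : ℕ) [NeZero p] (hp : 3 ≤ p) :
    TreeDecomposition (hanoiGraph p n) (HanoiNode p n) where
  tree := SimpleGraph.fromRel fun s t => s ≠ HanoiNode.ofConfig n le_rfl 0 ∧ s.parent = t
  isTree := by
    refine SimpleGraph.isTree_fromRel_parent _ _ (fun x => n - x.1.1) fun x hx => ?_
    have h : (x.1.1 : ℕ) < n := by
      by_contra h
      exact hx (HanoiNode.eq_root h)
    simp only [HanoiNode.parent, dif_pos h, HanoiNode.ofConfig]
    omega
  bag := HanoiNode.bag
  exists_mem_bag τ := ⟨_, HanoiNode.mem_bag_zero hp τ⟩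
  exists_edge_bag τ σ h := by
    obtain ⟨d, hd, h1, h2, h3⟩ := h
    -- At level `d + 1` disc `d` is unrestricted, and the two pegs of the move are clear of smaller
    -- discs.
    refine ⟨HanoiNode.ofConfig (d + 1) d.2 τ, ?_, ?_⟩
    · rw [HanoiNode.mem_bag_ofConfig]
      refine ⟨fun _ _ => rfl, τ d, σ d, hd.symm, fun e he => ?_⟩
      have : e < d := by rw [Fin.lt_def]; omega
      exact ⟨h2 e this, h3 e this⟩
    · rw [HanoiNode.mem_bag_ofConfig]
      refine ⟨fun e he => h1 e fun h => by rw [h] at he; omega, τ d, σ d, hd.symm, fun e he => ?_⟩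
      have : e < d := by rw [Fin.lt_def]; omega
      rw [h1 e this.ne]
      exact ⟨h2 e this, h3 e this⟩
  connected_bags τ := by
    have key : ∀ k (hk : k ≤ n) (h : τ ∈ (HanoiNode.ofConfig k hk τ).bag),
        ((SimpleGraph.fromRel fun s t : HanoiNode p n =>
          s ≠ HanoiNode.ofConfig n le_rfl 0 ∧ s.parent = t).induce {i | τ ∈ i.bag}).Reachable
          ⟨_, h⟩ ⟨_, HanoiNode.mem_bag_zero hp τ⟩ := by
      intro k
      induction k with
      | zero => intro _ _; exact .refl _
      | succ k ih =>
        intro hk h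
        -- Lowering the level restricts fewer discs, so the nodes of `τ` reach down to level `0`.
        have h' : τ ∈ (HanoiNode.ofConfig k (Nat.le_of_succ_le hk) τ).bag := by
          rw [HanoiNode.mem_bag_ofConfig] at h ⊢
          obtain ⟨-, a, b, hab, h⟩ := h
          exact ⟨fun _ _ => rfl, a, b, hab, fun e he => h e (by omega)⟩
        refine SimpleGraph.Reachable.trans (SimpleGraph.Adj.reachable ?_) (ih _ h')
        rw [SimpleGraph.comap_adj, SimpleGraph.fromRel_adj]
        refine ⟨fun he => ?_, .inr ⟨fun he => ?_, HanoiNode.parent_ofConfig hk τ⟩⟩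
        · have := congrArg (fun x : HanoiNode p n => (x.1.1 : ℕ)) he
          simp [HanoiNode.ofConfig] at this
        · have := congrArg (fun x : HanoiNode p n => (x.1.1 : ℕ)) he
          simp [HanoiNode.ofConfig] at this
          omega
    have key' : ∀ x : {i : HanoiNode p n | τ ∈ i.bag},
        ((SimpleGraph.fromRel fun s t : HanoiNode p n =>
          s ≠ HanoiNode.ofConfig n le_rfl 0 ∧ s.parent = t).induce {i | τ ∈ i.bag}).Reachable
          x ⟨_, HanoiNode.mem_bag_zero hp τ⟩ := by
      rintro ⟨x, h⟩
      have hx := HanoiNode.eq_ofConfig h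
      have h' : τ ∈ (HanoiNode.ofConfig x.1.1 (Nat.le_of_lt_succ x.1.1.2) τ).bag := hx ▸ h
      have := key x.1.1 (Nat.le_of_lt_succ x.1.1.2) h'
      convert this using 1
      exact Subtype.ext hx
    exact
      { preconnected := fun x y => (key' x).trans (key' y).symm
        nonempty := ⟨⟨_, HanoiNode.mem_bag_zero hp τ⟩⟩ }

theorem treewidth_hanoiGraph_le (p n : ℕ) [NeZero p] (hp : 3 ≤ p) :
    treewidth (hanoiGraph p n) ≤ p ^ 3 * (p - 2) ^ n := by
  refine (hanoiTreeDecomposition p n hp).treewidth_le.trans ?_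
  exact (Nat.sub_le _ _).trans (Finset.sup_le fun x _ => x.card_bag_le hp)

/-! ### Lower bound: splitting off the largest disc -/

namespace Hanoi

open SimpleGraph Classical

variable {p n : ℕ}

/-- Put a new largest disc on the peg `i`. -/
def addDisc (τ : HanoiConfig p n) (i : Fin p) : HanoiConfig p (n + 1) :=
  Fin.snoc (α := fun _ => Fin p) τ i

@[simp] theorem addDisc_castSucc (τ : HanoiConfig p n) (i : Fin p) (e : Fin n) :
    addDisc τ i e.castSucc = τ e := Fin.snoc_castSucc (α := fun _ => Fin p) _ _ _

@[simp] theorem addDisc_last (τ : HanoiConfig p n) (i : Fin p) :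
    addDisc τ i (Fin.last n) = i := Fin.snoc_last (α := fun _ => Fin p) _ _

theorem addDisc_init (τ : HanoiConfig p (n + 1)) :
    addDisc (fun e => τ e.castSucc) (τ (Fin.last n)) = τ :=
  Fin.snoc_init_self (α := fun _ => Fin p) τ

theorem addDisc_left_injective (i : Fin p) :
    Function.Injective fun τ : HanoiConfig p n => addDisc τ i := fun τ σ h => by
  funext e
  have := congrFun h e.castSucc
  simpa using this

theorem move_addDisc {τ σ : HanoiConfig p n} (h : HanoiMove τ σ) (i : Fin p) :
    HanoiMove (addDisc τ i) (addDisc σ i) := by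
  obtain ⟨d, h0, h1, h2, h3⟩ := h
  refine ⟨d.castSucc, by simpa using h0, fun e => ?_, fun e => ?_, fun e => ?_⟩ <;>
    refine Fin.lastCases ?_ (fun e => ?_) e
  · simp
  · intro he; simpa using h1 e (by simpa using he)
  · intro he; exact absurd he (not_lt.2 (Fin.le_last _))
  · intro he; simpa using h2 e (by simpa using he)
  · intro he; exact absurd he (not_lt.2 (Fin.le_last _))
  · intro he; simpa using h3 e (by simpa using he)

theorem move_last {τ : HanoiConfig p n} {i j : Fin p} (hij : i ≠ j)
    (h : ∀ e, τ e ≠ i ∧ τ e ≠ j) : HanoiMove (addDisc τ i) (addDisc τ j) := by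
  refine ⟨Fin.last n, by simpa using hij.symm, fun e => ?_, fun e => ?_, fun e => ?_⟩ <;>
    refine Fin.lastCases ?_ (fun e => ?_) e
  · simp
  · simp
  · simp
  · intro _; simpa using (h e).1
  · simp
  · intro _; simpa using (h e).2

/-- The configurations of the smaller discs that lie in `X` when the largest disc is on `i`. -/
noncomputable def slice (X : Finset (HanoiConfig p (n + 1))) (i : Fin p) :
    Finset (HanoiConfig p n) :=
  Finset.univ.filter fun τ => addDisc τ i ∈ X

@[simp] theorem mem_slice {X : Finset (HanoiConfig p (n + 1))} {i : Fin p}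
    {τ : HanoiConfig p n} : τ ∈ slice X i ↔ addDisc τ i ∈ X := by
  simp [slice]

theorem sum_card_slice_le (X : Finset (HanoiConfig p (n + 1))) :
    ∑ i, (slice X i).card ≤ X.card := by
  rw [Finset.card_eq_sum_card_fiberwise (s := X) (t := Finset.univ)
    (f := fun v => v (Fin.last n)) (by simp)]
  refine Finset.sum_le_sum fun i _ => ?_
  refine Finset.card_le_card_of_injOn (fun τ => addDisc τ i) (fun τ hτ => ?_)
    (addDisc_left_injective i).injOn
  simpa using hτ

theorem reachableAvoiding_addDisc {X : Finset (HanoiConfig p (n + 1))} {i : Fin p}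
    {τ σ : HanoiConfig p n} (h : (hanoiGraph p n).ReachableAvoiding (slice X i) τ σ) :
    (hanoiGraph p (n + 1)).ReachableAvoiding X (addDisc τ i) (addDisc σ i) :=
  h.map (fun τ => addDisc τ i) (fun _ _ h => move_addDisc h i) fun _ h => by simpa using h

theorem reachableAvoiding_last {X : Finset (HanoiConfig p (n + 1))} {i j : Fin p}
    {τ : HanoiConfig p n} (hij : i ≠ j) (h : ∀ e, τ e ≠ i ∧ τ e ≠ j) (hi : τ ∉ slice X i)
    (hj : τ ∉ slice X j) :
    (hanoiGraph p (n + 1)).ReachableAvoiding X (addDisc τ i) (addDisc τ j) :=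
  .of_adj (move_last hij h) (by simpa using hi) (by simpa using hj)

/-- Identify the pegs `a` and `b` with the peg `c`. -/
def collapse (a b c x : Fin p) : Fin p := if x = a ∨ x = b then c else x

/-- Discs on three pegs can be rearranged arbitrarily without touching the other discs. -/
theorem reachableAvoiding_of_collapse_eq {a b c : Fin p} (hab : a ≠ b) (hac : a ≠ c)
    (hbc : b ≠ c) {X : Finset (HanoiConfig p n)} {v v' : HanoiConfig p n}
    (h : ∀ e, collapse a b c (v' e) = collapse a b c (v e))
    (hX : ∀ w ∈ X, ∃ e, collapse a b c (w e) ≠ collapse a b c (v e)) :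
    (hanoiGraph p n).ReachableAvoiding X v v' := by
  induction n with
  | zero =>
    rw [Subsingleton.elim v' v]
    exact .refl fun hv => by obtain ⟨e, _⟩ := hX v hv; exact e.elim0
  | succ n ih =>
    obtain ⟨τ, i, rfl⟩ : ∃ τ i, v = addDisc τ i := ⟨_, _, (addDisc_init v).symm⟩
    obtain ⟨τ', j, rfl⟩ : ∃ τ i, v' = addDisc τ i := ⟨_, _, (addDisc_init v').symm⟩
    have hτ : ∀ e, collapse a b c (τ' e) = collapse a b c (τ e) := fun e => by
      simpa using h e.castSucc
    have hij : collapse a b c j = collapse a b c i := by simpa using h (Fin.last n)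
    have hslice : ∀ (k : Fin p), collapse a b c k = collapse a b c i →
        ∀ σ : HanoiConfig p n, (∀ e, collapse a b c (σ e) = collapse a b c (τ e)) →
        ∀ w ∈ slice X k, ∃ e, collapse a b c (w e) ≠ collapse a b c (σ e) := by
      intro k hk σ hσ w hw
      obtain ⟨e, he⟩ := hX _ (mem_slice.1 hw)
      revert he
      refine Fin.lastCases (fun he => ?_) (fun e he => ⟨e, ?_⟩) e
      · simp [hk] at he
      · rw [hσ]; simpa using he
    by_cases hne : i = j
    · subst hne
      exact reachableAvoiding_addDisc (ih hτ (hslice i rfl τ fun _ => rfl))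
    · have hi : collapse a b c i = c := by
        unfold collapse at hij ⊢; grind
      obtain ⟨m, hmi, hmj, hm⟩ : ∃ m, m ≠ i ∧ m ≠ j ∧ collapse a b c m = c := by
        have hj := hij.trans hi
        by_cases h1 : a ≠ i ∧ a ≠ j
        · exact ⟨a, h1.1, h1.2, by simp [collapse]⟩
        by_cases h2 : b ≠ i ∧ b ≠ j
        · exact ⟨b, h2.1, h2.2, by simp [collapse]⟩
        · exact ⟨c, by grind, by grind, by simp [collapse]⟩
      -- The smaller discs on the three pegs are parked on the third peg `m` while the largest disc
      -- moves.
      let σ : HanoiConfig p n := fun e => if collapse a b c (τ e) = c then m else τ e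
      have hσ : ∀ e, collapse a b c (σ e) = collapse a b c (τ e) := fun e => by
        simp only [σ]; split_ifs with he
        · rw [hm, he]
        · rfl
      have hσ' : ∀ e, σ e ≠ i ∧ σ e ≠ j := fun e => by
        simp only [σ]; split_ifs with he
        · exact ⟨hmi, hmj⟩
        · exact ⟨fun h => he (h ▸ hi), fun h => he (h ▸ hij.trans hi)⟩
      have h1 := ih hσ (hslice i rfl τ fun _ => rfl)
      have h2 := ih (fun e => (hτ e).trans (hσ e).symm) (hslice j hij σ hσ)
      exact ((reachableAvoiding_addDisc h1).trans
        (reachableAvoiding_last hne hσ' h1.right_notMem h2.left_notMem)).trans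
        (reachableAvoiding_addDisc h2)

/-! ### Clearing pegs by swaps -/

/-- Swapping the empty peg `b` with `c`, using another empty peg `a`, along disjoint sets of
configurations. -/
theorem card_not_reachableAvoiding_swap_le {a b c : Fin p} (hab : a ≠ b) (hac : a ≠ c)
    (X : Finset (HanoiConfig p n)) :
    (Finset.univ.filter fun z : HanoiConfig p n => (∀ e, z e ≠ a ∧ z e ≠ b) ∧
      ¬ (hanoiGraph p n).ReachableAvoiding X z fun e => Equiv.swap b c (z e)).card ≤ X.card := by
  by_cases hbc : b = c
  · subst hbc
    refine Finset.card_le_card fun z hz => ?_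
    rw [Finset.mem_filter] at hz
    by_contra h
    exact hz.2.2 (by simpa using ReachableAvoiding.refl h)
  -- As `z` avoids `a` and `b`, it is its own collapse, hence is recovered from any vertex of `X`
  -- that obstructs its swap.
  · refine (Finset.card_le_card fun z hz => ?_).trans
      (Finset.card_image_le (s := X) (f := fun w e => collapse a b c (w e)))
    rw [Finset.mem_filter] at hz
    obtain ⟨-, hz, hr⟩ := hz
    rw [Finset.mem_image]
    by_contra! hX
    have hcol : ∀ e, collapse a b c (z e) = z e := fun e => by
      simp [collapse, (hz e).1, (hz e).2]
    refine hr (reachableAvoiding_of_collapse_eq hab hac hbc (fun e => ?_) fun w hw => ?_)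
    · have := hz e
      simp only [collapse, Equiv.swap_apply_def]
      grind
    · by_contra! h
      exact hX w hw (funext fun e => (h e).trans (hcol e))

/-- With `j ≠ b`, swap `a` and `j` with `b` as the spare peg, then `b` and `i` with the now empty
`j` as the spare peg. Each swap fails for at most `X.card` configurations. -/
theorem exists_perm_of_ne {a b i j : Fin p} (hab : a ≠ b) (hia : i ≠ a) (hib : i ≠ b)
    (hij : i ≠ j) :
    ∃ φ : Equiv.Perm (Fin p), (∀ x, x ≠ a ∧ x ≠ b → φ x ≠ i ∧ φ x ≠ j) ∧
      ∀ X : Finset (HanoiConfig p n),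
        (Finset.univ.filter fun z : HanoiConfig p n => (∀ e, z e ≠ a ∧ z e ≠ b) ∧
          ¬ (hanoiGraph p n).ReachableAvoiding X z fun e => φ (z e)).card ≤ 2 * X.card := by
  wlog hjb : j ≠ b generalizing a b
  · obtain ⟨φ, h1, h2⟩ := this hab.symm hib hia (by push Not at hjb; rw [hjb]; exact hab.symm)
    exact ⟨φ, fun x hx => h1 x hx.symm, fun X => by simpa only [and_comm] using h2 X⟩
  have hs : ∀ x, x ≠ a ∧ x ≠ b → Equiv.swap a j x ≠ j ∧ Equiv.swap a j x ≠ b := fun x hx => by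
    simp only [Equiv.swap_apply_def]; grind
  refine ⟨(Equiv.swap a j).trans (Equiv.swap b i), fun x hx => ?_, fun X => ?_⟩
  · have := hs x hx
    rw [Equiv.trans_apply]
    generalize Equiv.swap a j x = y at this
    simp only [Equiv.swap_apply_def]; grind
  · have h1 := card_not_reachableAvoiding_swap_le (a := b) (b := a) (c := j) hab.symm hjb.symm X
    have h2 := card_not_reachableAvoiding_swap_le (a := j) (b := b) (c := i) hjb hij.symm X
    have h3 : (Finset.univ.filter fun z : HanoiConfig p n => (∀ e, z e ≠ a ∧ z e ≠ b) ∧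
        ¬ (hanoiGraph p n).ReachableAvoiding X (fun e => Equiv.swap a j (z e))
          fun e => Equiv.swap b i (Equiv.swap a j (z e))).card ≤ X.card := by
      refine le_trans (Finset.card_le_card_of_injOn (fun z e => Equiv.swap a j (z e))
        (fun z hz => ?_) fun z _ z' _ h => ?_) h2
      · simp only [Finset.coe_filter, Finset.mem_univ, true_and, Set.mem_ofPred_eq] at hz ⊢
        exact ⟨fun e => hs _ (hz.1 e), hz.2⟩
      · exact funext fun e => (Equiv.swap a j).injective (congrFun h e)
    rw [two_mul]
    refine (Finset.card_le_card fun z hz => ?_).trans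
      ((Finset.card_union_le _ _).trans (Nat.add_le_add h1 h3))
    simp only [Finset.mem_union, Finset.mem_filter, Finset.mem_univ, true_and] at hz ⊢
    by_cases h : (hanoiGraph p n).ReachableAvoiding X z fun e => Equiv.swap a j (z e)
    · exact .inr ⟨hz.1, fun h' => hz.2 (h.trans h')⟩
    · exact .inl ⟨fun e => (hz.1 e).symm, h⟩

/-- The smaller discs can be cleared away from the pegs `i` and `j`, for all but few of the
configurations that avoid the pegs `a` and `b`, along a map that permutes the pegs. -/
theorem exists_perm {a b i : Fin p} (hab : a ≠ b) (hia : i ≠ a) (hib : i ≠ b) (j : Fin p) :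
    ∃ (φ : Equiv.Perm (Fin p)) (a' b' : Fin p), a' ≠ b' ∧ (i ≠ j → a' = i ∧ b' = j) ∧
      (∀ x, x ≠ a ∧ x ≠ b → φ x ≠ a' ∧ φ x ≠ b') ∧
      ∀ X : Finset (HanoiConfig p n),
        (Finset.univ.filter fun z : HanoiConfig p n => (∀ e, z e ≠ a ∧ z e ≠ b) ∧
          ¬ (hanoiGraph p n).ReachableAvoiding X z fun e => φ (z e)).card ≤ 2 * X.card := by
  by_cases hij : i = j
  · refine ⟨1, a, b, hab, fun h => absurd hij h, fun x hx => hx, fun X => ?_⟩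
    refine (Finset.card_le_card fun z hz => ?_).trans (Nat.le_mul_of_pos_left _ two_pos)
    rw [Finset.mem_filter] at hz
    by_contra h
    exact hz.2.2 (.refl h)
  · obtain ⟨φ, h1, h2⟩ := exists_perm_of_ne (n := n) hab hia hib hij
    exact ⟨φ, i, j, hij, fun _ => ⟨rfl, rfl⟩, h1, h2⟩

/-! ### Counting separated pairs -/

/-- The pairs of a configuration that avoids the pegs `a` and `b` and an arbitrary configuration
that are separated by `X`. -/
noncomputable def separatedPairs (a b : Fin p) (X : Finset (HanoiConfig p n)) :
    Finset (HanoiConfig p n × HanoiConfig p n) :=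
  Finset.univ.filter fun x => (∀ e, x.1 e ≠ a ∧ x.1 e ≠ b) ∧
    ¬ (hanoiGraph p n).ReachableAvoiding X x.1 x.2

/-- The pairs separated by `X` after placing the largest disc on `i` and on `j`, respectively. -/
theorem card_separatedPairs_addDisc_le {a b i : Fin p} (hab : a ≠ b) (hia : i ≠ a) (hib : i ≠ b)
    (j : Fin p) (X : Finset (HanoiConfig p (n + 1))) {N : ℕ}
    (hN : ∀ a' b' : Fin p, a' ≠ b' → (separatedPairs a' b' (slice X j)).card ≤ N) :
    (Finset.univ.filter fun x : HanoiConfig p n × HanoiConfig p n =>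
      (∀ e, x.1 e ≠ a ∧ x.1 e ≠ b) ∧
        ¬ (hanoiGraph p (n + 1)).ReachableAvoiding X (addDisc x.1 i) (addDisc x.2 j)).card ≤
      2 * (slice X i).card * p ^ n + N := by
  obtain ⟨φ, a', b', hab', hij, hφ, hcard⟩ := exists_perm (n := n) hab hia hib j
  have h1 : ((Finset.univ.filter fun z : HanoiConfig p n => (∀ e, z e ≠ a ∧ z e ≠ b) ∧
      ¬ (hanoiGraph p n).ReachableAvoiding (slice X i) z fun e => φ (z e)) ×ˢ
      (Finset.univ : Finset (HanoiConfig p n))).card ≤ 2 * (slice X i).card * p ^ n := by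
    rw [Finset.card_product, Finset.card_univ]
    refine Nat.mul_le_mul (hcard _) ?_
    simp
  have h2 : (Finset.univ.filter fun x : HanoiConfig p n × HanoiConfig p n =>
      ((fun e => φ (x.1 e), x.2) : HanoiConfig p n × HanoiConfig p n) ∈
        separatedPairs a' b' (slice X j)).card ≤ N := by
    refine le_trans (Finset.card_le_card_of_injOn (fun x => (fun e => φ (x.1 e), x.2))
      (fun x hx => ?_) fun x _ y _ h => ?_) (hN a' b' hab')
    · simpa using hx
    · rw [Prod.ext_iff] at h
      exact Prod.ext (funext fun e => φ.injective (congrFun h.1 e)) h.2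
  refine (Finset.card_le_card fun x hx => ?_).trans
    ((Finset.card_union_le _ _).trans (Nat.add_le_add h1 h2))
  simp only [separatedPairs, Finset.mem_union, Finset.mem_filter, Finset.mem_univ, true_and,
    Finset.mem_product, and_true] at hx ⊢
  obtain ⟨hx, hr⟩ := hx
  by_contra! h
  have ha := h.1 hx
  have hb := h.2 fun e => hφ _ (hx e)
  refine hr ((reachableAvoiding_addDisc ha).trans
    (ReachableAvoiding.trans ?_ (reachableAvoiding_addDisc hb)))
  by_cases hne : i = j
  · subst hne
    exact .refl (reachableAvoiding_addDisc ha).right_notMem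
  · obtain ⟨rfl, rfl⟩ := hij hne
    exact reachableAvoiding_last hne (fun e => hφ _ (hx e)) ha.right_notMem hb.left_notMem

/-- Allowing every pair `a ≠ b` keeps the induction going: after the largest disc has moved, the
empty pegs are `i` and `j`. -/
theorem card_separatedPairs_le (hp : 2 ≤ p) {a b : Fin p} (hab : a ≠ b)
    (X : Finset (HanoiConfig p n)) : (separatedPairs a b X).card ≤ X.card * p ^ (n + 1) := by
  induction n generalizing a b with
  | zero =>
    by_cases hX : X.card = 0
    · rw [Finset.card_eq_zero] at hX
      subst hX
      rw [separatedPairs, Finset.filter_eq_empty_iff.2]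
      · simp
      · rintro ⟨x, y⟩ _ ⟨_, h⟩
        rw [Subsingleton.elim y x] at h
        exact h (.refl (Finset.notMem_empty _))
    · refine (Finset.card_le_univ _).trans ?_
      have : 0 < X.card * p := Nat.mul_pos (Nat.pos_of_ne_zero hX) (by omega)
      simp
      omega
  | succ n ih =>
    let S : Finset (Fin p × Fin p) := (Finset.univ \ {a, b}) ×ˢ Finset.univ
    let B : Fin p × Fin p → Finset (HanoiConfig p n × HanoiConfig p n) := fun c =>
      Finset.univ.filter fun x => (∀ e, x.1 e ≠ a ∧ x.1 e ≠ b) ∧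
        ¬ (hanoiGraph p (n + 1)).ReachableAvoiding X (addDisc x.1 c.1) (addDisc x.2 c.2)
    have hsub : separatedPairs a b X ⊆ S.biUnion fun c =>
        (B c).image fun x => (addDisc x.1 c.1, addDisc x.2 c.2) := by
      rintro ⟨z, y⟩ hx
      simp only [separatedPairs, Finset.mem_filter, Finset.mem_univ, true_and] at hx
      rw [Finset.mem_biUnion]
      refine ⟨(z (Fin.last n), y (Fin.last n)), ?_, ?_⟩
      · simpa [S] using hx.1 (Fin.last n)
      · rw [Finset.mem_image]
        refine ⟨(fun e => z e.castSucc, fun e => y e.castSucc), ?_, ?_⟩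
        · simp only [B, Finset.mem_filter, Finset.mem_univ, true_and, addDisc_init]
          exact ⟨fun e => hx.1 _, hx.2⟩
        · simp only [addDisc_init]
    have hB : ∀ c ∈ S, ((B c).image fun x => (addDisc x.1 c.1, addDisc x.2 c.2)).card ≤
        2 * (slice X c.1).card * p ^ n + (slice X c.2).card * p ^ (n + 1) := by
      intro c hc
      have hc' : c.1 ≠ a ∧ c.1 ≠ b := by simpa [S] using hc
      exact Finset.card_image_le.trans (card_separatedPairs_addDisc_le hab hc'.1 hc'.2 c.2 X
        fun a' b' h => ih h _)
    have hsum := sum_card_slice_le X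
    calc (separatedPairs a b X).card
        ≤ ∑ c ∈ S, (2 * (slice X c.1).card * p ^ n + (slice X c.2).card * p ^ (n + 1)) :=
          (Finset.card_le_card hsub).trans (Finset.card_biUnion_le.trans (Finset.sum_le_sum hB))
      _ = p * ((∑ i ∈ Finset.univ \ {a, b}, (slice X i).card) * (2 * p ^ n)) +
            (p - 2) * ((∑ j, (slice X j).card) * p ^ (n + 1)) := by
          rw [Finset.sum_product, Finset.sum_mul, Finset.sum_mul]
          simp only [Finset.sum_add_distrib, Finset.sum_const, Finset.card_univ, Fintype.card_fin,
            smul_eq_mul, Finset.mul_sum]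
          rw [Finset.card_sdiff_of_subset (Finset.subset_univ _), Finset.card_pair hab,
            Finset.card_univ, Fintype.card_fin]
          congr 1
          refine Finset.sum_congr rfl fun _ _ => by ring
      _ ≤ p * (X.card * (2 * p ^ n)) + (p - 2) * (X.card * p ^ (n + 1)) := by
          have h1 : ∑ i ∈ Finset.univ \ {a, b}, (slice X i).card ≤ X.card :=
            (Finset.sum_le_sum_of_subset (Finset.subset_univ _)).trans hsum
          gcongr
      -- The two swaps exactly make up for the two pegs denied to the largest disc: `2 + (p - 2) =
      -- p`.
      _ = X.card * p ^ (n + 1 + 1) := by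
          obtain ⟨q, rfl⟩ := Nat.exists_eq_add_of_le hp
          rw [Nat.add_sub_cancel_left]
          ring

/-- After the removal of few configurations, more than half of all configurations are connected. -/
theorem exists_reachableAvoiding (hp : 3 ≤ p) {k : ℕ} (hk : 2 * p * k < (p - 2) ^ n)
    (X : Finset (HanoiConfig p n)) (hX : X.card ≤ k) :
    ∃ z, ∃ B : Finset (HanoiConfig p n), Fintype.card (HanoiConfig p n) < 2 * B.card ∧
      ∀ y ∈ B, (hanoiGraph p n).ReachableAvoiding X z y := by
  let a : Fin p := ⟨0, by omega⟩
  let b : Fin p := ⟨1, by omega⟩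
  have hab : a ≠ b := by simp [a, b]
  let S : Finset (HanoiConfig p n) := Fintype.piFinset fun _ => Finset.univ \ {a, b}
  have hS : S.card = (p - 2) ^ n := by
    simp only [S, Fintype.card_piFinset, Finset.prod_const, Finset.card_univ, Fintype.card_fin]
    rw [Finset.card_sdiff_of_subset (Finset.subset_univ _), Finset.card_pair hab,
      Finset.card_univ, Fintype.card_fin]
  have hmem : ∀ z ∈ S, ∀ e, z e ≠ a ∧ z e ≠ b := fun z hz e => by
    simpa using Fintype.mem_piFinset.1 hz e
  let B : HanoiConfig p n → Finset (HanoiConfig p n) := fun z =>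
    Finset.univ.filter fun y => (hanoiGraph p n).ReachableAvoiding X z y
  by_contra! hall
  have hB : ∀ z, 2 * (B z).card ≤ p ^ n := fun z => by
    by_contra! h
    obtain ⟨y, hy, hy'⟩ := hall z (B z) (by simpa using h)
    exact hy' (Finset.mem_filter.1 hy).2
  have hBc : ∀ z, p ^ n ≤ 2 * (B z)ᶜ.card := fun z => by
    have := Finset.card_add_card_compl (B z)
    have h' : Fintype.card (HanoiConfig p n) = p ^ n := by simp
    have := hB z
    omega
  have hle : (S.sigma fun z => (B z)ᶜ).card ≤ (separatedPairs a b X).card := by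
    refine Finset.card_le_card_of_injOn (fun x => (x.1, x.2)) (fun x hx => ?_) ?_
    · have hx' := Finset.mem_sigma.1 hx
      simp only [separatedPairs, Finset.coe_filter, Finset.mem_univ, true_and, Set.mem_ofPred_eq]
      exact ⟨hmem _ hx'.1, by simpa [B] using hx'.2⟩
    · rintro ⟨x, y⟩ _ ⟨x', y'⟩ _ h
      simpa using h
  have h1 := card_separatedPairs_le (by omega) hab X
  have h2 : (p - 2) ^ n * p ^ n ≤ 2 * (S.sigma fun z => (B z)ᶜ).card := by
    rw [Finset.card_sigma, Finset.mul_sum, ← hS, ← smul_eq_mul]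
    exact Finset.card_nsmul_le_sum _ _ _ fun z _ => hBc z
  have h3 : (p - 2) ^ n * p ^ n ≤ (2 * p * k) * p ^ n := by
    calc _ ≤ 2 * (X.card * p ^ (n + 1)) := h2.trans (Nat.mul_le_mul_left _ (hle.trans h1))
      _ ≤ 2 * (k * p ^ (n + 1)) := by gcongr
      _ = _ := by ring
  exact absurd (Nat.le_of_mul_le_mul_right h3 (pow_pos (by omega) _)) (not_le.2 hk)

end Hanoi

/-! ### Conclusion -/

/-- For `n = 0` the graph is a single vertex of treewidth `0`, so `0 < n` is needed. An edge gives
width at least `1`, which absorbs the rounding and doubles `2 * p` to `4 * p`. -/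
theorem le_treewidth_hanoiGraph (p n : ℕ) [NeZero p] (hp : 3 ≤ p) (hn : 0 < n) :
    (p - 2) ^ n ≤ 4 * p * treewidth (hanoiGraph p n) := by
  obtain ⟨κ, _, D, hD⟩ := exists_width_eq_treewidth (hanoiTreeDecomposition p n hp)
  rw [← hD]
  have h1 : 1 ≤ D.width := by
    let a : Fin p := ⟨0, by omega⟩
    let b : Fin p := ⟨1, by omega⟩
    refine D.one_le_width_of_adj (u := fun _ => a)
      (v := Function.update (fun _ => a) ⟨0, hn⟩ b) ⟨⟨0, hn⟩, ?_, fun e he => ?_, fun e he => ?_,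
        fun e he => ?_⟩
    · simp [a, b]
    · simp [he]
    · exact absurd he (by simp [Fin.lt_def])
    · exact absurd he (by simp [Fin.lt_def])
  have hpos : 0 < (p - 2) ^ n := pow_pos (by omega) _
  -- The largest `k` with `2 * p * k < (p - 2) ^ n`.
  have h2 : ((p - 2) ^ n - 1) / (2 * p) ≤ D.width := by
    refine D.le_width_of_forall_reachableAvoiding (Hanoi.exists_reachableAvoiding hp ?_)
    have := Nat.mul_div_le ((p - 2) ^ n - 1) (2 * p)
    omega
  have h3 : (p - 2) ^ n - 1 < 2 * p * (D.width + 1) :=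
    (Nat.div_lt_iff_lt_mul (by omega)).1 (Nat.lt_succ_of_le h2) |>.trans_eq (mul_comm _ _)
  have h4 : 2 * p * (D.width + 1) ≤ 4 * p * D.width := by
    calc 2 * p * (D.width + 1) ≤ 2 * p * (D.width + D.width) := by gcongr
      _ = _ := by ring
  omega

theorem corollary2 (p : ℕ) [NeZero p] (hp : 3 ≤ p) :
    (fun n : ℕ => (treewidth (hanoiGraph p n) : ℝ)) =Θ[atTop]
      (fun n : ℕ => ((p : ℝ) - 2) ^ n) := by
  have hcast : ∀ n : ℕ, (((p - 2) ^ n : ℕ) : ℝ) = ((p : ℝ) - 2) ^ n := fun n => by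
    rw [Nat.cast_pow, Nat.cast_sub (by omega), Nat.cast_ofNat]
  simp only [← hcast]
  constructor
  · refine IsBigO.of_bound ((p : ℝ) ^ 3) (Eventually.of_forall fun n => ?_)
    rw [Real.norm_natCast, Real.norm_natCast]
    exact_mod_cast treewidth_hanoiGraph_le p n hp
  · refine IsBigO.of_bound (4 * p : ℝ) (eventually_atTop.2 ⟨1, fun n hn => ?_⟩)
    rw [Real.norm_natCast, Real.norm_natCast]
    exact_mod_cast le_treewidth_hanoiGraph p n hp hn
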